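/- Let $\mathcal H$ be a separable infinite-dimensional complex Hilbert space, let $A>0$ be a real number, and let $\mathbf c=(c_i)_{i\in\mathbb N}$ be a sequence of real numbers with $0<c_i\le A$ for all $i$. Put $J=\{i\in\mathbb N: c_i=A\}$ and assume that $\sum_{i\notin J}c_i=\infty$. Then the conditions $\limsup_{i\notin J}c_i<A$ and $\sup_{i\notin J}c_i<A$ are equivalent. If they hold, then the pair $(A\,I,\mathbf c)$ is frame admissible, that is, there is a frame $(f_i)_{i\in\mathbb N}$ for $\mathcal H$ (a sequence for which there are constants $a,b>0$ with $a\|x\|^2\le\sum_{i}|\langle x,f_i\rangle|^2\le b\|x\|^2$ for all $x\in\mathcal H$) whose frame operator $x\mapsto\sum_{i}\langle x,f_i\rangle f_i$ equals $A\,I$ and which satisfies $\|f_i\|^2=c_i$ for all $i\in\mathbb N$. In particular, there is a tight frame $(f_i)_{i\in\mathbb N}$ for $\mathcal H$ with frame constant $A$ (the largest possible $a$ and the smallest possible $b$ are both equal to $A$) and $\|f_i\|^2=c_i$ for all $i\in\mathbb N$. -/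

import Mathlib

open scoped ENNReal

/-- `∑ₙ |⟨x, fₙ⟩|²` converges for every `x`, and there are constants `a, b > 0` with
`a‖x‖² ≤ ∑ₙ |⟨x, fₙ⟩|² ≤ b‖x‖²`. Mathlib's inner product is linear in its second variable, so the
textbook `⟨x, fₙ⟩` (linear in `x`) is `inner ℂ (f n) x`. -/
def IsFrame {H : Type*} [NormedAddCommGroup H] [InnerProductSpace ℂ H] (f : ℕ → H) : Prop :=
  (∀ x : H, Summable fun n => ‖inner ℂ (f n) x‖ ^ 2) ∧
    ∃ a b : ℝ, 0 < a ∧ 0 < b ∧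
      ∀ x : H, a * ‖x‖ ^ 2 ≤ ∑' n, ‖inner ℂ (f n) x‖ ^ 2 ∧
        ∑' n, ‖inner ℂ (f n) x‖ ^ 2 ≤ b * ‖x‖ ^ 2

/-- The (optimal) frame bounds of the frame `f` are `a` and `b`: `a` is the largest admissible
lower constant and `b` is the smallest admissible upper constant. -/
def HasFrameBounds {H : Type*} [NormedAddCommGroup H] [InnerProductSpace ℂ H]
    (f : ℕ → H) (a b : ℝ) : Prop :=
  IsFrame f ∧
    IsGreatest {t : ℝ | 0 < t ∧ ∀ x : H, t * ‖x‖ ^ 2 ≤ ∑' n, ‖inner ℂ (f n) x‖ ^ 2} a ∧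
    IsLeast {t : ℝ | 0 < t ∧ ∀ x : H, ∑' n, ‖inner ℂ (f n) x‖ ^ 2 ≤ t * ‖x‖ ^ 2} b

/-- `f` is a tight frame with frame constant `A`: both optimal frame bounds are `A`. -/
def IsTightFrame {H : Type*} [NormedAddCommGroup H] [InnerProductSpace ℂ H]
    (f : ℕ → H) (A : ℝ) : Prop :=
  HasFrameBounds f A A

/-- `S` is the frame operator of `f`: `S x = ∑ₙ ⟨x, fₙ⟩ fₙ` for every `x`. -/
def HasFrameOperator {H : Type*} [NormedAddCommGroup H] [InnerProductSpace ℂ H]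
    (f : ℕ → H) (S : H →L[ℂ] H) : Prop :=
  ∀ x : H, HasSum (fun n => inner ℂ (f n) x • f n) (S x)

/-- The pair `(S, c)` is frame admissible: some frame has frame operator `S` and squared
norms `c`. -/
def FrameAdmissible {H : Type*} [NormedAddCommGroup H] [InnerProductSpace ℂ H]
    (S : H →L[ℂ] H) (c : ℕ → ℝ) : Prop :=
  ∃ f : ℕ → H, IsFrame f ∧ HasFrameOperator f S ∧ ∀ k, ‖f k‖ ^ 2 = c k

open Filter Topology

/-! Scale to `A = 1` and build the frame greedily, keeping the partial frame operator in the form `P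
- (1 - l) v v*`, with `P` the projection onto the span of the first `m` basis vectors. If the next
squared norm `c` satisfies `l + c ≤ 1`, add `√c v`. Otherwise a rank-one update in the plane of `v`
and `e m` changes the eigenvalues `l, 0` into `1, l + c - 1`; the deficient direction turns to `s v
+ t (e m)` with `s ^ 2 ≤ c`.

The strict gap `b < 1` enters here. Since the norms outside `J` have divergent sum, infinitely many
updates use some `c ≤ b`; each multiplies the old coordinates of `v` by `s` with `s ^ 2 ≤ b`. So `v`
tends weakly to zero, the defect vanishes strongly, `P` tends to the identity, and the partial sums
converge to `x`. A Bessel estimate makes this convergence unconditional. -/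

/-- The trigonometric data of a rank-one update of `(1 - l) v v* + e e*` that fills up one
eigenvalue. -/
theorem exists_rankOne_coefficients {l c : ℝ} (hl1 : l ≤ 1) (hc1 : c ≤ 1) (h : 1 < l + c) :
    ∃ s t p q : ℝ, 0 ≤ s ∧ s ^ 2 ≤ c ∧ s ^ 2 + t ^ 2 = 1 ∧ p ^ 2 + q ^ 2 = c ∧
      (2 - l - c) * s ^ 2 + p ^ 2 = 1 - l ∧ (2 - l - c) * t ^ 2 + q ^ 2 = 1 ∧
      (2 - l - c) * (s * t) + p * q = 0 := by
  have hl : 0 < l := by linarith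
  have hc : 0 < c := by linarith
  rcases eq_or_lt_of_le (show 0 ≤ 2 - l - c by linarith) with hd | hd
  · have h1 : l = 1 := by linarith
    have h2 : c = 1 := by linarith
    subst h1 h2
    exact ⟨0, 1, 0, 1, by norm_num, by norm_num, by norm_num, by norm_num, by norm_num,
      by norm_num, by norm_num⟩
  · have hs : 0 ≤ (l + c - 1) * (1 - l) / (l * (2 - l - c)) :=
      div_nonneg (mul_nonneg (by linarith) (by linarith)) (by positivity)
    have ht : 0 ≤ (1 - c) / (l * (2 - l - c)) := div_nonneg (by linarith) (by positivity)
    have hp : 0 ≤ (1 - l) * (1 - c) / l :=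
      div_nonneg (mul_nonneg (by linarith) (by linarith)) hl.le
    have hq : 0 ≤ (l + c - 1) / l := div_nonneg (by linarith) hl.le
    -- The updated matrix has determinant `l * q ^ 2 = l + c - 1`, which fixes `q ^ 2`, then `p ^ 2
    -- = c - q ^ 2`; the diagonal equations give `s ^ 2` and `t ^ 2`, and the off-diagonal one
    -- forces the sign of `p`.
    refine ⟨√((l + c - 1) * (1 - l) / (l * (2 - l - c))), √((1 - c) / (l * (2 - l - c))),
      -√((1 - l) * (1 - c) / l), √((l + c - 1) / l), Real.sqrt_nonneg _, ?_, ?_, ?_, ?_, ?_, ?_⟩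
    · rw [Real.sq_sqrt hs, div_le_iff₀ (by positivity)]
      -- The difference of the two sides is `(1 - c) * (l * c + (1 - l) ^ 2)`.
      nlinarith [mul_nonneg (sub_nonneg.2 hl1) (sub_nonneg.2 hc1),
        mul_nonneg (mul_nonneg hc.le (sub_nonneg.2 hc1)) hl.le,
        mul_nonneg (sub_nonneg.2 hc1) hl.le, mul_nonneg (sub_nonneg.2 hc1) hd.le,
        mul_nonneg (sub_nonneg.2 hc1) (sub_nonneg.2 h.le),
        mul_nonneg (mul_nonneg (sub_nonneg.2 hc1) (sub_nonneg.2 hl1)) (sub_nonneg.2 h.le),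
        mul_nonneg (sub_nonneg.2 hc1) (sq_nonneg (1 - l))]
    · rw [Real.sq_sqrt hs, Real.sq_sqrt ht]
      field_simp
      ring
    · rw [neg_sq, Real.sq_sqrt hp, Real.sq_sqrt hq]
      field_simp
      ring
    · rw [neg_sq, Real.sq_sqrt hp, Real.sq_sqrt hs]
      field_simp
      ring
    · rw [Real.sq_sqrt ht, Real.sq_sqrt hq]
      field_simp
      ring
    · have key : √((1 - l) * (1 - c) / l) * √((l + c - 1) / l) =
          (2 - l - c) * (√((l + c - 1) * (1 - l) / (l * (2 - l - c))) *
            √((1 - c) / (l * (2 - l - c)))) := by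
        rw [← Real.sqrt_mul hp, ← Real.sqrt_mul hs]
        refine (Real.sqrt_eq_iff_mul_self_eq (mul_nonneg hp hq)
          (mul_nonneg hd.le (Real.sqrt_nonneg _))).2 ?_
        rw [mul_mul_mul_comm, Real.mul_self_sqrt (mul_nonneg hs ht)]
        field_simp
      rw [neg_mul, key]
      ring

/-- A nonincreasing nonnegative sequence which infinitely often shrinks by a factor `b < 1`
tends to zero. -/
theorem tendsto_zero_of_frequently_le_mul {a : ℕ → ℝ} {b : ℝ} (hb : b < 1) {N : ℕ}
    (h0 : ∀ n, 0 ≤ a n) (ha : ∀ n, N ≤ n → a (n + 1) ≤ a n)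
    (hf : ∃ᶠ n in atTop, a (n + 1) ≤ b * a n) : Tendsto a atTop (𝓝 0) := by
  have hanti : Antitone fun n => a (n + N) := antitone_nat_of_succ_le fun n => by
    simpa [Nat.add_right_comm] using ha (n + N) (Nat.le_add_left _ _)
  have hlim := (tendsto_add_atTop_iff_nat N).1 (tendsto_atTop_ciInf hanti
    ⟨0, by rintro _ ⟨n, rfl⟩; exact h0 _⟩)
  set L := ⨅ n, a (n + N)
  have hL0 : 0 ≤ L := ge_of_tendsto' hlim h0
  have hLb : L - b * L ≤ 0 := by
    refine le_of_tendsto_of_frequently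
      (((tendsto_add_atTop_iff_nat 1).2 hlim).sub (hlim.const_mul b)) (hf.mono fun n hn => ?_)
    linarith
  have : L = 0 := by nlinarith
  rwa [this] at hlim

section HilbertSpace

variable {H : Type*} [NormedAddCommGroup H] [InnerProductSpace ℂ H]

theorem Orthonormal.countable_of_separableSpace [TopologicalSpace.SeparableSpace H]
    {ι : Type*} {v : ι → H} (hv : Orthonormal ℂ v) : Countable ι := by
  refine Pairwise.countable_of_isOpen_disjoint (s := fun i => Metric.ball (v i) (1 / 2)) ?_
    (fun i => Metric.isOpen_ball) (fun i => ⟨v i, Metric.mem_ball_self (by norm_num)⟩)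
  intro i j hij
  refine Metric.ball_disjoint_ball ?_
  have h : ‖v i - v j‖ ^ 2 = 2 := by
    rw [@norm_sub_sq ℂ, hv.1 i, hv.1 j, hv.2 hij]
    norm_num
  rw [dist_eq_norm]
  nlinarith [norm_nonneg (v i - v j)]

theorem nonempty_hilbertBasis_nat [CompleteSpace H] [TopologicalSpace.SeparableSpace H]
    (hH : ¬ FiniteDimensional ℂ H) : Nonempty (HilbertBasis ℕ ℂ H) := by
  obtain ⟨w, b, hb⟩ := exists_hilbertBasis ℂ H
  have : Countable w := b.orthonormal.countable_of_separableSpace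
  have : Infinite w := by
    by_contra hfin
    rw [not_infinite_iff_finite] at hfin
    have := Fintype.ofFinite w
    exact hH b.toOrthonormalBasis.toBasis.finiteDimensional_of_finite
  obtain ⟨φ⟩ := nonempty_equiv_of_countable (α := ℕ) (β := w)
  refine ⟨HilbertBasis.mk (b.orthonormal.comp φ φ.injective) ?_⟩
  rw [φ.surjective.range_comp, b.dense_span]

/-! ### Greedy construction of the frame vectors -/

/-- The partial frame operator is `P - (1 - l) v v*`, where `P` is the projection onto the span of
`e 0, …, e (m - 1)` and `v` is a unit vector in that span; `m`, `l`, `v` are recorded here. -/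
structure PartialFrameState (e : ℕ → H) where
  dim : ℕ
  weight : ℝ
  vec : H
  weight_nonneg : 0 ≤ weight
  weight_le : weight ≤ 1
  norm_vec : ‖vec‖ = 1
  inner_vec : ∀ k, dim ≤ k → inner ℂ (e k) vec = (0 : ℂ)

/-- The operator `P - (1 - l) v v*` described by a state. -/
noncomputable def PartialFrameState.op {e : ℕ → H} (S : PartialFrameState e) (x : H) : H :=
  (∑ k ∈ Finset.range S.dim, (inner ℂ (e k) x : ℂ) • e k) -
    ((1 - S.weight : ℝ) : ℂ) • (inner ℂ S.vec x : ℂ) • S.vec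

/-- `T` arises from `S` by adding the frame vector `f` of squared norm `c`; the unit vector is
contracted by the factor `s` on the old span. -/
structure PartialFrameStep {e : ℕ → H} (S T : PartialFrameState e) (c : ℝ) (f : H) (s : ℝ) :
    Prop where
  norm_sq : ‖f‖ ^ 2 = c
  op_eq : ∀ x, T.op x = S.op x + (inner ℂ f x : ℂ) • f
  nonneg : 0 ≤ s
  le_one : s ≤ 1
  inner_vec : ∀ k, k < S.dim → inner ℂ (e k) T.vec = (s : ℂ) * inner ℂ (e k) S.vec
  cases : (T.dim = S.dim ∧ T.weight = S.weight + c) ∨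
    (s ^ 2 ≤ c ∧ T.dim = S.dim + 1 ∧ T.weight = S.weight + c - 1)

theorem PartialFrameState.exists_step {e : ℕ → H} (he : Orthonormal ℂ e)
    (S : PartialFrameState e) {c : ℝ} (hc : 0 ≤ c) (hc1 : c ≤ 1) :
    ∃ (T : PartialFrameState e) (f : H) (s : ℝ), PartialFrameStep S T c f s := by
  obtain ⟨m, l, v, hl0, hl1, hv, hm⟩ := S
  by_cases h : l + c ≤ 1
  · refine ⟨⟨m, l + c, v, by linarith, h, hv, hm⟩, ((√c : ℝ) : ℂ) • v, 1,
      ⟨?_, ?_, zero_le_one, le_rfl, by simp, Or.inl ⟨rfl, rfl⟩⟩⟩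
    · rw [norm_smul, hv, mul_one, Complex.norm_real, Real.norm_eq_abs, sq_abs, Real.sq_sqrt hc]
    · intro x
      simp only [PartialFrameState.op, inner_smul_left, Complex.conj_ofReal, smul_smul]
      have hcc : ((√c : ℝ) : ℂ) * ((√c : ℝ) : ℂ) = c := by
        rw [← Complex.ofReal_mul, Real.mul_self_sqrt hc]
      have : ((√c : ℝ) : ℂ) * inner ℂ v x * ((√c : ℝ) : ℂ) = c * inner ℂ v x := by
        rw [← hcc]; ring
      rw [this]
      push_cast
      module
  · obtain ⟨s, t, p, q, hs0, hsc, hst, hpq, h1, h2, h3⟩ :=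
      exists_rankOne_coefficients hl1 hc1 (not_le.1 h)
    have hve : inner ℂ v (e m) = (0 : ℂ) := inner_eq_zero_symm.1 (hm m le_rfl)
    have hnorm : ∀ a b : ℝ, ‖(a : ℂ) • v + (b : ℂ) • e m‖ ^ 2 = a ^ 2 + b ^ 2 := by
      intro a b
      rw [@norm_add_sq ℂ, norm_smul, norm_smul, hv, he.1 m, inner_smul_left, inner_smul_right, hve]
      simp
    refine ⟨⟨m + 1, l + c - 1, (s : ℂ) • v + (t : ℂ) • e m, by linarith, by linarith, ?_, ?_⟩,
      (p : ℂ) • v + (q : ℂ) • e m, s, ⟨?_, ?_, hs0, ?_, ?_, Or.inr ⟨hsc, rfl, rfl⟩⟩⟩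
    · have := hnorm s t
      rw [hst] at this
      exact (pow_eq_one_iff_of_nonneg (norm_nonneg _) two_ne_zero).1 this
    · intro k hk
      rw [inner_add_right, inner_smul_right, inner_smul_right, hm k (by omega),
        he.2 (show k ≠ m by omega)]
      simp
    · rw [hnorm, hpq]
    · intro x
      simp only [PartialFrameState.op, inner_add_left, inner_smul_left, Complex.conj_ofReal,
        Finset.sum_range_succ]
      have h1' : (2 - (l : ℂ) - c) * s ^ 2 + p ^ 2 = 1 - l := by exact_mod_cast h1
      have h2' : (2 - (l : ℂ) - c) * t ^ 2 + q ^ 2 = 1 := by exact_mod_cast h2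
      have h3' : (2 - (l : ℂ) - c) * (s * t) + p * q = 0 := by exact_mod_cast h3
      push_cast
      match_scalars
      · ring
      · linear_combination (-inner ℂ (e m) x) * h2' - (inner ℂ v x) * h3'
      · linear_combination (-inner ℂ v x) * h1' - (inner ℂ (e m) x) * h3'
    · nlinarith
    · intro k hk
      rw [inner_add_right, inner_smul_right, inner_smul_right, he.2 (show k ≠ m by
        intro hkm; subst hkm; exact lt_irrefl _ hk)]
      simp

/-- Bounded sequences in a Hilbert space whose coordinates tend to zero converge weakly to zero. -/
theorem HilbertBasis.tendsto_inner_zero (e : HilbertBasis ℕ ℂ H) {v : ℕ → H}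
    (hv : ∀ n, ‖v n‖ = 1) (h : ∀ k, Tendsto (fun n => (inner ℂ (e k) (v n) : ℂ)) atTop (𝓝 0))
    (x : H) : Tendsto (fun n => (inner ℂ (v n) x : ℂ)) atTop (𝓝 0) := by
  rw [Metric.tendsto_atTop]
  intro ε hε
  obtain ⟨m, hm⟩ := Metric.tendsto_atTop.1 (e.hasSum_repr x).tendsto_sum_nat (ε / 2) (by positivity)
  have hm := hm m le_rfl
  set y := ∑ i ∈ Finset.range m, e.repr x i • e i
  have hy : Tendsto (fun n => (inner ℂ (v n) y : ℂ)) atTop (𝓝 0) := by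
    have : Tendsto (fun n => ∑ i ∈ Finset.range m, e.repr x i * (inner ℂ (v n) (e i) : ℂ)) atTop
        (𝓝 (∑ i ∈ Finset.range m, e.repr x i * 0)) := by
      refine tendsto_finsetSum _ fun i _ => Tendsto.const_mul _ ?_
      rw [tendsto_zero_iff_norm_tendsto_zero]
      simpa only [norm_inner_symm] using tendsto_zero_iff_norm_tendsto_zero.1 (h i)
    simpa [y, inner_sum, inner_smul_right] using this
  obtain ⟨N, hN⟩ := Metric.tendsto_atTop.1 hy (ε / 2) (by positivity)
  refine ⟨N, fun n hn => ?_⟩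
  have h1 := hN n hn
  rw [dist_zero_right] at h1 ⊢
  have h2 : (inner ℂ (v n) x : ℂ) = inner ℂ (v n) y - inner ℂ (v n) (y - x) := by
    rw [inner_sub_right]; ring
  have h3 : ‖(inner ℂ (v n) (y - x) : ℂ)‖ ≤ ‖y - x‖ := by
    simpa only [hv n, one_mul] using norm_inner_le_norm (𝕜 := ℂ) (v n) (y - x)
  rw [dist_eq_norm] at hm
  rw [h2]
  linarith [norm_sub_le (inner ℂ (v n) y : ℂ) (inner ℂ (v n) (y - x))]

theorem HilbertBasis.exists_norm_sq_eq_and_tendsto_sum (e : HilbertBasis ℕ ℂ H) {c : ℕ → ℝ}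
    {b : ℝ} (hb : b < 1) (hc : ∀ i, 0 ≤ c i) (hcb : ∀ i, c i = 1 ∨ c i ≤ b)
    (hsum : ¬ Summable fun i => if c i = 1 then 0 else c i) :
    ∃ f : ℕ → H, (∀ i, ‖f i‖ ^ 2 = c i) ∧ ∀ x, Tendsto
      (fun n => ∑ i ∈ Finset.range n, (inner ℂ (f i) x : ℂ) • f i) atTop (𝓝 x) := by
  have hc1 : ∀ i, c i ≤ 1 := fun i => by rcases hcb i with h | h <;> linarith
  -- With `m = 1`, `l = 0`, `v = e 0` the operator is zero, matching the empty sum.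
  let S₀ : PartialFrameState (e : ℕ → H) := ⟨1, 0, e 0, le_rfl, zero_le_one, e.orthonormal.1 0,
    fun k hk => e.orthonormal.2 (by omega)⟩
  choose next g r hstep using fun (n : ℕ) (S : PartialFrameState (e : ℕ → H)) =>
    S.exists_step e.orthonormal (hc n) (hc1 n)
  let S : ℕ → PartialFrameState (e : ℕ → H) := fun n => Nat.rec S₀ (fun n T => next n T) n
  have hS : ∀ n, PartialFrameStep (S n) (S (n + 1)) (c n) (g n (S n)) (r n (S n)) :=
    fun n => hstep n (S n)
  have hop : ∀ x n, ∑ i ∈ Finset.range n, (inner ℂ (g i (S i)) x : ℂ) • g i (S i) = (S n).op x := by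
    intro x n
    induction n with
    | zero => simp [S, S₀, PartialFrameState.op]
    | succ n ih => rw [Finset.sum_range_succ, ih, (hS n).op_eq]
  -- Otherwise, from some point on, every step with `c n ≠ 1` adds `c n` to the weight and no step
  -- lowers it, so the weight bound `1` would make the sum outside `J` converge.
  have hfreq : ∃ᶠ n in atTop, r n (S n) ^ 2 ≤ b ∧ (S (n + 1)).dim = (S n).dim + 1 := by
    intro hev
    obtain ⟨N, hN⟩ := eventually_atTop.1 hev
    apply hsum
    rw [← summable_nat_add_iff N]
    refine summable_of_sum_range_le (c := 1) (fun n => ?_) fun n => ?_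
    · split_ifs
      exacts [le_rfl, hc _]
    · suffices h : ∑ i ∈ Finset.range n, (if c (i + N) = 1 then 0 else c (i + N)) ≤
          (S (n + N)).weight from h.trans (S (n + N)).weight_le
      induction n with
      | zero => simpa using (S _).weight_nonneg
      | succ n ih =>
        rw [Finset.sum_range_succ, Nat.add_right_comm]
        rcases (hS (n + N)).cases with ⟨-, h⟩ | ⟨h1, h2, h3⟩
        · rw [h]
          have := hc (n + N)
          split_ifs <;> linarith
        · rcases hcb (n + N) with h4 | h4
          · rw [if_pos h4, h3]
            linarith
          · exact absurd ⟨h1.trans h4, h2⟩ (hN (n + N) (Nat.le_add_left _ _))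
  have hmono : Monotone fun n => (S n).dim := monotone_nat_of_le_succ fun n => by
    rcases (hS n).cases with h | h <;> omega
  have hdim : Tendsto (fun n => (S n).dim) atTop atTop := by
    refine tendsto_atTop_atTop_of_monotone hmono fun m => ?_
    induction m with
    | zero => exact ⟨0, Nat.zero_le _⟩
    | succ m ih =>
      obtain ⟨a, ha⟩ := ih
      obtain ⟨n, hn, -, hn'⟩ := frequently_atTop.1 hfreq a
      exact ⟨n + 1, by have := hmono hn; simp only at this; omega⟩
  have hcoord : ∀ k, Tendsto (fun n => (inner ℂ (e k) (S n).vec : ℂ)) atTop (𝓝 0) := by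
    intro k
    obtain ⟨N, hN⟩ := eventually_atTop.1 (hdim.eventually_gt_atTop k)
    have hrec : ∀ n, N ≤ n → ‖(inner ℂ (e k) (S (n + 1)).vec : ℂ)‖ ^ 2 =
        r n (S n) ^ 2 * ‖(inner ℂ (e k) (S n).vec : ℂ)‖ ^ 2 := fun n hn => by
      rw [(hS n).inner_vec k (hN n hn), norm_mul, mul_pow, Complex.norm_real, Real.norm_eq_abs,
        sq_abs]
    have hsq : Tendsto (fun n => ‖(inner ℂ (e k) (S n).vec : ℂ)‖ ^ 2) atTop (𝓝 0) := by
      refine tendsto_zero_of_frequently_le_mul hb (N := N) (fun n => by positivity)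
        (fun n hn => ?_) ((hfreq.and_eventually (eventually_ge_atTop N)).mono ?_)
      · rw [hrec n hn]
        exact mul_le_of_le_one_left (by positivity) (pow_le_one₀ (hS n).nonneg (hS n).le_one)
      · rintro n ⟨⟨h, -⟩, hn⟩
        rw [hrec n hn]
        gcongr
    rw [tendsto_zero_iff_norm_tendsto_zero]
    simpa [Real.sqrt_sq] using hsq.sqrt
  refine ⟨fun n => g n (S n), fun n => (hS n).norm_sq, fun x => ?_⟩
  simp only [hop]
  have h1 := (e.hasSum_repr x).tendsto_sum_nat.comp hdim
  have h2 : Tendsto (fun n => ((1 - (S n).weight : ℝ) : ℂ) • (inner ℂ (S n).vec x : ℂ) • (S n).vec)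
      atTop (𝓝 0) := by
    refine squeeze_zero_norm (fun n => ?_) (tendsto_zero_iff_norm_tendsto_zero.1
      (e.tendsto_inner_zero (fun n => (S n).norm_vec) hcoord x))
    rw [norm_smul, norm_smul, (S n).norm_vec, mul_one, Complex.norm_real, Real.norm_eq_abs]
    refine mul_le_of_le_one_left (norm_nonneg _) (abs_le.2 ⟨?_, ?_⟩) <;>
      linarith [(S n).weight_le, (S n).weight_nonneg]
  simpa [PartialFrameState.op, Function.comp_def, e.repr_apply_apply] using h1.sub h2

/-! ### From ordered to unconditional convergence -/

theorem hasSum_norm_inner_sq_of_tendsto {f : ℕ → H} {x y : H}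
    (h : Tendsto (fun n => ∑ i ∈ Finset.range n, (inner ℂ (f i) x : ℂ) • f i) atTop (𝓝 y)) :
    HasSum (fun n => ‖(inner ℂ (f n) x : ℂ)‖ ^ 2) (RCLike.re (inner ℂ x y : ℂ)) := by
  rw [hasSum_iff_tendsto_nat_of_nonneg (fun n => by positivity)]
  have h1 := (RCLike.continuous_re (K := ℂ)).continuousAt.tendsto.comp
    ((tendsto_const_nhds (x := x)).inner (𝕜 := ℂ) h)
  refine h1.congr fun n => ?_
  simp only [Function.comp_apply, inner_sum, inner_smul_right, map_sum]
  refine Finset.sum_congr rfl fun i _ => ?_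
  rw [← inner_conj_symm x (f i), RCLike.mul_conj]
  norm_cast

/-- Pair the sum `y` with itself, apply Cauchy–Schwarz, use the Bessel bound at `y`, and cancel `‖y‖
^ 2`. -/
theorem norm_sum_inner_smul_sq_le {ι : Type*} {f : ι → H}
    (h : ∀ (s : Finset ι) (x : H), ∑ i ∈ s, ‖(inner ℂ (f i) x : ℂ)‖ ^ 2 ≤ ‖x‖ ^ 2)
    (s : Finset ι) (x : H) :
    ‖∑ i ∈ s, (inner ℂ (f i) x : ℂ) • f i‖ ^ 2 ≤ ∑ i ∈ s, ‖(inner ℂ (f i) x : ℂ)‖ ^ 2 := by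
  set y := ∑ i ∈ s, (inner ℂ (f i) x : ℂ) • f i with hy
  have h1 : ‖y‖ ^ 2 ≤ ∑ i ∈ s, ‖(inner ℂ (f i) x : ℂ)‖ * ‖(inner ℂ (f i) y : ℂ)‖ := by
    have h0 : (inner ℂ y y : ℂ) = ∑ i ∈ s, (inner ℂ (f i) x : ℂ) * inner ℂ y (f i) := by
      nth_rw 2 [hy]
      simp only [inner_sum, inner_smul_right]
    have h1 : ‖y‖ ^ 2 = ‖(inner ℂ y y : ℂ)‖ := by
      rw [inner_self_eq_norm_sq_to_K]
      simp
    rw [h1, h0]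
    refine (norm_sum_le _ _).trans (Finset.sum_le_sum fun i _ => ?_)
    rw [norm_mul, norm_inner_symm y (f i)]
  have h2 := Finset.sum_mul_sq_le_sq_mul_sq s (fun i => ‖(inner ℂ (f i) x : ℂ)‖)
    (fun i => ‖(inner ℂ (f i) y : ℂ)‖)
  have h3 : (‖y‖ ^ 2) ^ 2 ≤ (∑ i ∈ s, ‖(inner ℂ (f i) x : ℂ)‖ ^ 2) * ‖y‖ ^ 2 :=
    (pow_le_pow_left₀ (by positivity) h1 2).trans (h2.trans (by gcongr; exact h s y))
  rcases eq_or_lt_of_le (sq_nonneg ‖y‖) with h0 | h0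
  · rw [← h0]
    exact Finset.sum_nonneg fun i _ => by positivity
  · exact le_of_mul_le_mul_right (by rwa [sq] at h3) h0

/-- Ordered convergence gives Parseval's identity, hence a Bessel bound; it carries the Cauchy
criterion from the squared coefficients to the vectors. -/
theorem hasSum_inner_smul_of_tendsto [CompleteSpace H] {f : ℕ → H}
    (h : ∀ x, Tendsto (fun n => ∑ i ∈ Finset.range n, (inner ℂ (f i) x : ℂ) • f i) atTop (𝓝 x))
    (x : H) : HasSum (fun n => (inner ℂ (f n) x : ℂ) • f n) x := by
  have hsq : ∀ x, HasSum (fun n => ‖(inner ℂ (f n) x : ℂ)‖ ^ 2) (‖x‖ ^ 2) := fun x => by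
    simpa only [inner_self_eq_norm_sq] using hasSum_norm_inner_sq_of_tendsto (h x)
  have hle := norm_sum_inner_smul_sq_le (f := f) fun s x =>
    sum_le_hasSum s (fun i _ => by positivity) (hsq x)
  have hs : Summable fun n => (inner ℂ (f n) x : ℂ) • f n := by
    rw [summable_iff_vanishing_norm]
    intro ε hε
    obtain ⟨s, hs⟩ := summable_iff_vanishing_norm.1 (hsq x).summable (ε ^ 2) (by positivity)
    refine ⟨s, fun t ht => lt_of_pow_lt_pow_left₀ 2 hε.le ((hle t x).trans_lt ?_)⟩
    exact (le_abs_self _).trans_lt (hs t ht)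
  have := hs.hasSum
  rwa [tendsto_nhds_unique this.tendsto_sum_nat (h x)] at this

end HilbertSpace

/-- Only finitely many terms exceed a level between the limsup and `A`, and their maximum is still
below `A`. -/
theorem limsup_cofinite_lt_iff_iSup_lt {ι : Type*} [Infinite ι] {u : ι → ℝ} {A : ℝ}
    (h0 : ∀ i, 0 ≤ u i) (h : ∀ i, u i < A) :
    limsup u cofinite < A ↔ (⨆ i, u i) < A := by
  have hbdd : BddAbove (Set.range u) := ⟨A, by rintro _ ⟨i, rfl⟩; exact (h i).le⟩
  constructor
  · intro hl
    obtain ⟨b, hb, hbA⟩ := exists_between hl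
    have hfin := eventually_lt_of_limsup_lt hb hbdd.isBoundedUnder_of_range
    rw [eventually_cofinite] at hfin
    obtain ⟨M, hM, hMA⟩ : ∃ M, (∀ i ∈ {i | ¬ u i < b}, u i ≤ M) ∧ M < A := by
      rcases Set.eq_empty_or_nonempty {i | ¬ u i < b} with he | hne
      · exact ⟨b, fun i hi => by rw [he] at hi; exact hi.elim, hbA⟩
      · obtain ⟨j, -, hj⟩ := Set.exists_max_image _ u hfin hne
        exact ⟨u j, hj, h j⟩
    refine lt_of_le_of_lt (ciSup_le fun i => ?_) (max_lt hbA hMA)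
    by_cases hi : u i < b
    · exact le_max_of_le_left hi.le
    · exact le_max_of_le_right (hM i hi)
  · refine lt_of_le_of_lt (limsup_le_of_le ?_ (Eventually.of_forall fun i => le_ciSup hbdd i))
    exact IsBoundedUnder.isCoboundedUnder_le
      ⟨0, eventually_map.2 (Eventually.of_forall h0)⟩

theorem corollary5p5 {H : Type*} [NormedAddCommGroup H] [InnerProductSpace ℂ H]
    [CompleteSpace H] [TopologicalSpace.SeparableSpace H] (hH : ¬ FiniteDimensional ℂ H)
    (A : ℝ) (hA : 0 < A) (c : ℕ → ℝ) (hc : ∀ i, 0 < c i ∧ c i ≤ A)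
    (J : Set ℕ) (hJ : J = {i | c i = A})
    (hsum : ∑' i : {i // i ∉ J}, ENNReal.ofReal (c i) = ∞) :
    (Filter.limsup (fun i : {i // i ∉ J} => c i) Filter.cofinite < A ↔
        (⨆ i : {i // i ∉ J}, c i) < A) ∧
      (Filter.limsup (fun i : {i // i ∉ J} => c i) Filter.cofinite < A →
        FrameAdmissible ((A : ℂ) • ContinuousLinearMap.id ℂ H) c ∧
          ∃ f : ℕ → H, IsTightFrame f A ∧ ∀ i, ‖f i‖ ^ 2 = c i) := by
  have hmem : ∀ i, i ∈ J ↔ c i = A := fun i => by rw [hJ]; rfl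
  have hnsum : ¬ Summable fun i : {i // i ∉ J} => c i := fun h => h.tsum_ofReal_ne_top hsum
  have hinf : Infinite {i // i ∉ J} := by
    by_contra hfin
    rw [not_infinite_iff_finite] at hfin
    exact hnsum (Summable.of_finite)
  have hiff := limsup_cofinite_lt_iff_iSup_lt (u := fun i : {i // i ∉ J} => c i) (A := A)
    (fun i => (hc i).1.le)
    (fun i => lt_of_le_of_ne (hc i).2 fun h => i.2 ((hmem i).2 h))
  refine ⟨hiff, fun hlim => ?_⟩
  obtain ⟨e⟩ := nonempty_hilbertBasis_nat hH
  have hbdd : BddAbove (Set.range fun i : {i // i ∉ J} => c i) :=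
    ⟨A, by rintro _ ⟨i, rfl⟩; exact (hc i).2⟩
  obtain ⟨g, hg, hgx⟩ := e.exists_norm_sq_eq_and_tendsto_sum (c := fun i => c i / A)
    (b := (⨆ i : {i // i ∉ J}, c i) / A) ((div_lt_one hA).2 (hiff.1 hlim))
    (fun i => div_nonneg (hc i).1.le hA.le)
    (fun i => by
      by_cases hi : i ∈ J
      · exact Or.inl ((div_eq_one_iff_eq hA.ne').2 ((hmem i).1 hi))
      · exact Or.inr (div_le_div_of_nonneg_right (le_ciSup hbdd ⟨i, hi⟩) hA.le))
    (fun h => hnsum (by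
      refine ((h.subtype Jᶜ).mul_left A).congr fun i => ?_
      have hi : c i ≠ A := fun h => i.2 ((hmem i).2 h)
      simp [div_eq_one_iff_eq hA.ne', hi, mul_div_cancel₀ _ hA.ne']))
  have hAA : ((√A : ℝ) : ℂ) * ((√A : ℝ) : ℂ) = A := by
    rw [← Complex.ofReal_mul, Real.mul_self_sqrt hA.le]
  set f : ℕ → H := fun n => ((√A : ℝ) : ℂ) • g n with hf
  have hfn : ∀ i, ‖f i‖ ^ 2 = c i := fun i => by
    rw [hf, norm_smul, mul_pow, hg, Complex.norm_real, Real.norm_eq_abs, sq_abs,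
      Real.sq_sqrt hA.le, mul_div_cancel₀ _ hA.ne']
  have hfop : HasFrameOperator f ((A : ℂ) • ContinuousLinearMap.id ℂ H) := fun x => by
    have := (hasSum_inner_smul_of_tendsto hgx x).const_smul (A : ℂ)
    change HasSum _ ((A : ℂ) • x)
    convert this using 2 with n
    rw [hf, inner_smul_left, Complex.conj_ofReal, smul_smul, smul_smul, ← hAA]
    ring_nf
  have hfsq : ∀ x, HasSum (fun n => ‖(inner ℂ (f n) x : ℂ)‖ ^ 2) (A * ‖x‖ ^ 2) := fun x => by
    have := hasSum_norm_inner_sq_of_tendsto (hfop x).tendsto_sum_nat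
    simpa [inner_smul_right, ← inner_self_eq_norm_sq (𝕜 := ℂ)] using this
  have hframe : IsFrame f := ⟨fun x => (hfsq x).summable, A, A, hA, hA, fun x => by
    rw [(hfsq x).tsum_eq]; exact ⟨le_rfl, le_rfl⟩⟩
  -- A unit vector on which to test that both bounds are optimal.
  have hone : ‖e 0‖ = 1 := e.orthonormal.1 0
  refine ⟨⟨f, hframe, hfop, hfn⟩, f, ⟨hframe, ⟨⟨hA, fun x => (hfsq x).tsum_eq.ge⟩, ?_⟩,
    ⟨hA, fun x => (hfsq x).tsum_eq.le⟩, ?_⟩, hfn⟩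
  · rintro t ⟨-, ht⟩
    simpa [(hfsq (e 0)).tsum_eq, hone] using ht (e 0)
  · rintro t ⟨-, ht⟩
    simpa [(hfsq (e 0)).tsum_eq, hone] using ht (e 0)
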